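/- **Theorem (unsatisfiability of the unsatisfiable core in LTL).** Let $\varphi$ be an unsatisfiable LTL formula, let $C^{uc}$ be an unsatisfiable core (UC) in SNF of $\mathrm{SNF}(\varphi)$, extracted from any execution of the temporal resolution procedure below on $\mathrm{SNF}(\varphi)$ that derives the empty clause, and let $\varphi^{uc}$ be the LTL formula obtained by lifting $C^{uc}$ back to $\varphi$. Then $\varphi^{uc}$ is unsatisfiable. *LTL and SNF.* LTL formulas are built from $0,1$ and atomic propositions with $\neg,\vee,\wedge,\mathbf X,\mathbf U,\mathbf R,\mathbf F,\mathbf G$ and are interpreted over infinite words at time $0$. For finite sets (disjunctions) $P,Q$ of literals and a literal $l$, the SNF clauses are the initial clauses $(P)$, the global clauses $(\mathbf G(P\vee \mathbf X Q))$, written $(\mathbf G(P))$ if $Q=\emptyset$ ("empty $\mathbf X$ part"), and the eventuality clauses $(\mathbf G(P\vee\mathbf F l))$. The clauses $(0)$ and $(\mathbf G(0))$ are called empty, written $\Box$. *Translation.* An occurrence of a subformula $\psi$ of $\varphi$ is referenced by $x_\psi$, which is $\psi$ itself if $\psi$ is $0$, $1$ or an atomic proposition, and a fresh proposition (one per occurrence)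 otherwise. $\mathrm{SNF}(\varphi)$ consists of the initial clause $x_\varphi$ and, for each occurrence of a subformula, with $x$ denoting its own proposition, of the clauses $\mathbf G(\cdot)$ of the following implications (clauses simplified when $0$ or $1$ occurs in them, trivially true ones omitted). Positive polarity: $\neg\psi$: $x\to\neg x_\psi$. $\psi\wedge\psi'$: $x\to x_\psi$; $x\to x_{\psi'}$. $\psi\vee\psi'$: $x\to x_\psi\vee x_{\psi'}$. $\mathbf X\psi$: $x\to\mathbf X x_\psi$. $\mathbf G\psi$: $x\to\mathbf X x$; $x\to x_\psi$. $\mathbf F\psi$: $x\to\mathbf F x_\psi$. $\psi\mathbf U\psi'$: $x\to x_{\psi'}\vee x_\psi$; $x\to x_{\psi'}\vee\mathbf X x$; $x\to\mathbf F x_{\psi'}$. $\psi\mathbf R\psi'$: $x\to x_{\psi'}$; $x\to x_\psi\vee\mathbf X x$. Negative polarity: $\neg\psi$: $\neg x\to x_\psi$. $\psi\wedge\psi'$: $\neg x\to\neg x_\psi\vee\neg x_{\psi'}$. $\psi\vee\psi'$: $\neg x\to\neg x_\psi$; $\neg x\to\neg x_{\psi'}$. $\mathbf X\psi$: $\neg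 x\to\mathbf X\neg x_\psi$. $\mathbf G\psi$: $\neg x\to\mathbf F\neg x_\psi$. $\mathbf F\psi$: $\neg x\to\mathbf X\neg x$; $\neg x\to\neg x_\psi$. $\psi\mathbf U\psi'$: $\neg x\to\neg x_{\psi'}$; $\neg x\to\neg x_\psi\vee\mathbf X\neg x$. $\psi\mathbf R\psi'$: $\neg x\to\neg x_{\psi'}\vee\neg x_\psi$; $\neg x\to\neg x_{\psi'}\vee\mathbf X\neg x$; $\neg x\to\mathbf F\neg x_{\psi'}$. *Temporal resolution with resolution graph.* Input: a finite set $C$ of SNF clauses. The main partition $M$ starts as $C$, with one vertex per clause and no edges. Whenever a rule generates a clause that is new in its partition, a vertex is added for it, with edges from its premises except where stated otherwise. The procedure returns unsat when $\Box\in M$; this is tested at the start and after each saturation of $M$. (1) Saturate $M$, i.e. apply until nothing new arises: from $(P\vee l)$ and $(\neg l\vee Q)$ or $(\mathbf G(\neg l\vee Q))$ derive $(P\vee Q)$; from $(\mathbf G(P\vee l))$ and $(\mathbf G(\neg l\vee Q))$ derive $(\mathbf G(P\vee Q))$; from $(\mathbf G(P\vee l))$ and $(\mathbf G(Q\vee\mathbf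 X(\neg l\vee R)))$ derive $(\mathbf G(Q\vee\mathbf X(P\vee R)))$; and (step-xx) from $(\mathbf G(P\vee\mathbf X(Q\vee l)))$ and $(\mathbf G(R\vee\mathbf X(\neg l\vee S)))$ derive $(\mathbf G(P\vee R\vee\mathbf X(Q\vee S)))$. (2) Augment: for each eventuality clause $(\mathbf G(P\vee\mathbf F l))\in M$ add $(\mathbf G(P\vee l\vee w_l))$ and, without edge from the premise, $(\mathbf G(\neg w_l\vee\mathbf X(l\vee w_l)))$, where $w_l$ is fresh. Saturate $M$. (3) While $M$ changes, treat each eventuality clause $c=(\mathbf G(Q\vee\mathbf F l))\in C$, in any order, as follows. Put $C'=\{\Box\}$ and iterate: create a new partition $L$ that contains each $(\mathbf G(P\vee\mathbf X R))\in M$ with $R\ne\emptyset$, the clause $(\mathbf G(\mathbf X P))$ for each $(\mathbf G(P))\in M$, and, without edges, $(\mathbf G(\mathbf X(P\vee l)))$ for each $(\mathbf G(P))\in C'$; saturate $L$ under step-xx; let $C''$ be the old $C'$ and let the new $C'$ be the set of clauses with empty $\mathbf X$ part in $L$; for each $(\mathbf G(R))\in C''$ that is subsumed by some clause of $C'$ (i.e.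 contains its literals), add an edge from one such clause to $(\mathbf G(\mathbf X(R\vee l)))$ in $L$. A loop is found if all clauses of $C''$ are subsumed; the iteration stops when a loop is found or $C'=\emptyset$. If a loop is found, add to $M$, for each $(\mathbf G(P))\in C'$, the clause $(\mathbf G(P\vee Q\vee l))$ with edges from $(\mathbf G(P))$ in $L$ and from $c$, and the clause $(\mathbf G(\neg w_l\vee\mathbf X(P\vee l)))$ with an edge only from $(\mathbf G(P))$ in $L$; then saturate $M$. If a pass over all eventuality clauses does not change $M$, return sat. *UC in SNF.* If the procedure returns unsat on $C$, the UC of $C$ in SNF is the set of those $c\in C$ whose vertex in $M$ has a (possibly trivial) path in the resolution graph to a vertex of $M$ labeled with the empty clause $\Box$. *Lifting to LTL.* $\varphi^{uc}$ is obtained from $\varphi$ by replacing each occurrence of a proper subformula $\psi$ of positive (negative) polarity by $1$ (by $0$) iff no clause in $C^{uc}$ is one of the clauses listed above for the immediate superformula occurrence in which $x_\psi$ of that occurrence of $\psi$ appears. -/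

import Mathlib

/-! ## LTL -/

/-- LTL formulas over the atomic propositions `α`. -/
inductive LTL (α : Type*) where
  | tru : LTL α
  | fls : LTL α
  | atom : α → LTL α
  | neg : LTL α → LTL α
  | or : LTL α → LTL α → LTL α
  | and : LTL α → LTL α → LTL α
  | next : LTL α → LTL α
  | untl : LTL α → LTL α → LTL α
  | release : LTL α → LTL α → LTL α
  | eventually : LTL α → LTL α
  | always : LTL α → LTL α

namespace LTL

variable {α : Type*}

/-- `φ.Holds w i`: the formula `φ` holds at time `i` of the infinite word `w`. -/
def Holds (w : ℕ → Set α) : LTL α → ℕ → Prop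
  | tru, _ => True
  | fls, _ => False
  | atom a, i => a ∈ w i
  | neg φ, i => ¬ Holds w φ i
  | or φ ψ, i => Holds w φ i ∨ Holds w ψ i
  | and φ ψ, i => Holds w φ i ∧ Holds w ψ i
  | next φ, i => Holds w φ (i + 1)
  | untl φ ψ, i => ∃ k, i ≤ k ∧ Holds w ψ k ∧ ∀ j, i ≤ j → j < k → Holds w φ j
  | release φ ψ, i => ∀ k, i ≤ k → Holds w ψ k ∨ ∃ j, i ≤ j ∧ j < k ∧ Holds w φ j
  | eventually φ, i => ∃ k, i ≤ k ∧ Holds w φ k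
  | always φ, i => ∀ k, i ≤ k → Holds w φ k

def Satisfiable (φ : LTL α) : Prop := ∃ w : ℕ → Set α, φ.Holds w 0

/-- The Boolean constants `1` and `0`. -/
def ofBool : Bool → LTL α
  | true => tru
  | false => fls

end LTL

/-! ## Separated normal form -/

/-- The propositions that occur in SNF clauses: those of the LTL formula, one fresh proposition
`x` for each occurrence of a non-atomic subformula (an occurrence is given by the path to it
from the root of the syntax tree), and one fresh "wait for" proposition for each literal, where
`wait true p` belongs to the literal `p` and `wait false p` to the literal `¬ p`. -/
inductive SAtom (α : Type*) where
  | ap : α → SAtom α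
  | x : List Bool → SAtom α
  | wait : Bool → SAtom α → SAtom α
  deriving DecidableEq

/-- A literal: `⟨true, p⟩` is `p` and `⟨false, p⟩` is `¬ p`. -/
structure Lit (α : Type*) where
  sign : Bool
  var : SAtom α
  deriving DecidableEq

namespace Lit

variable {α : Type*}

def neg (l : Lit α) : Lit α := ⟨!l.sign, l.var⟩

/-- The positive literal of the "wait for" proposition of `l`. -/
def waitFor (l : Lit α) : Lit α := ⟨true, SAtom.wait l.sign l.var⟩

end Lit

/-- SNF clauses. A finite set of literals stands for its disjunction.
`initial P` is the clause `P`, `global P Q` is `G (P ∨ X Q)`, and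
`eventuality P l` is `G (P ∨ F l)`. -/
inductive Clause (α : Type*) where
  | initial : Finset (Lit α) → Clause α
  | global : Finset (Lit α) → Finset (Lit α) → Clause α
  | eventuality : Finset (Lit α) → Lit α → Clause α
  deriving DecidableEq

namespace Clause

variable {α : Type*}

/-- The empty clause, which is either `0` or `G 0`. -/
def IsEmptyClause (c : Clause α) : Prop := c = initial ∅ ∨ c = global ∅ ∅

def IsEventuality (c : Clause α) : Prop := ∃ P l, c = eventuality P l

end Clause

/-! ## Translation from LTL to SNF

The clauses for an occurrence of a subformula `ψ` are written as schemes over the propositions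
of that occurrence (`self`) and of its immediate subformula occurrences (`fst`, `snd`). -/

inductive Src where
  | self
  | fst
  | snd
  deriving DecidableEq

/-- A literal of a scheme: `(true, s)` is the proposition of `s`, `(false, s)` its negation. -/
abbrev SLit := Bool × Src

/-- `step P Q` is `G (P ∨ X Q)` and `ev P l` is `G (P ∨ F l)`. -/
inductive Scheme where
  | step : List SLit → List SLit → Scheme
  | ev : List SLit → SLit → Scheme

/-- The literals of a scheme. -/
def Scheme.lits : Scheme → List SLit
  | .step P Q => P ++ Q
  | .ev P l => P ++ [l]

/-- What references an occurrence of a subformula in the clauses of its superformula: a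
Boolean value or a proposition. -/
inductive Ref (α : Type*) where
  | const : Bool → Ref α
  | prop : SAtom α → Ref α

section Translation

variable {α : Type*} [DecidableEq α]

/-- The value or proposition itself (`true`) or its negation (`false`). -/
def Ref.signed : Ref α → Bool → Bool ⊕ Lit α
  | .const v, s => Sum.inl (v == s)
  | .prop p, s => Sum.inr ⟨s, p⟩

/-- A disjunction of literals and Boolean constants, simplified: `none` if the constant `1`
is a disjunct, otherwise the set of its literals. -/
def disj : List (Bool ⊕ Lit α) → Option (Finset (Lit α))
  | [] => some ∅
  | Sum.inl true :: _ => none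
  | Sum.inl false :: L => disj L
  | Sum.inr l :: L => (disj L).map (insert l)

/-- The clause given by a scheme when its propositions are given by `env`, after removal of the
Boolean constants; `none` if it is trivially true. -/
def Scheme.inst (env : Src → Ref α) : Scheme → Option (Clause α)
  | .step P Q =>
    match disj (P.map fun l => (env l.2).signed l.1),
        disj (Q.map fun l => (env l.2).signed l.1) with
    | some P', some Q' => some (.global P' Q')
    | _, _ => none
  | .ev P l =>
    match disj (P.map fun l => (env l.2).signed l.1), (env l.2).signed l.1 with
    | none, _ => none
    | some _, Sum.inl true => none
    | some P', Sum.inl false => some (.global P' ∅)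
    | some P', Sum.inr l' => some (.eventuality P' l')

namespace LTL

/-- What references the occurrence of a subformula at position `p`. -/
def ref (p : List Bool) : LTL α → Ref α
  | tru => .const true
  | fls => .const false
  | atom a => .prop (.ap a)
  | _ => .prop (.x p)

/-- What `self`, `fst` and `snd` stand for at the occurrence of a subformula at position `p`. -/
def env (p : List Bool) (ψ : LTL α) : Src → Ref α
  | .self => ψ.ref p
  | .fst =>
    match ψ with
    | neg ψ₁ | next ψ₁ | eventually ψ₁ | always ψ₁ => ψ₁.ref (p ++ [false])
    | or ψ₁ _ | and ψ₁ _ | untl ψ₁ _ | release ψ₁ _ => ψ₁.ref (p ++ [false])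
    | _ => .const true
  | .snd =>
    match ψ with
    | or _ ψ₂ | and _ ψ₂ | untl _ ψ₂ | release _ ψ₂ => ψ₂.ref (p ++ [true])
    | _ => .const true

/-- The translation table. `schemes true ψ` are the clauses for an occurrence of `ψ` of positive
polarity, of the form `G (x → …)`; `schemes false ψ` are those for an occurrence of negative
polarity, of the form `G (¬ x → …)`, where `x` is the proposition of `ψ`. -/
def schemes : Bool → LTL α → List Scheme
  | _, tru | _, fls | _, atom _ => []
  | true, neg _ => [.step [(false, .self), (false, .fst)] []]
  | false, neg _ => [.step [(true, .self), (true, .fst)] []]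
  | true, and _ _ =>
    [.step [(false, .self), (true, .fst)] [], .step [(false, .self), (true, .snd)] []]
  | false, and _ _ => [.step [(true, .self), (false, .fst), (false, .snd)] []]
  | true, or _ _ => [.step [(false, .self), (true, .fst), (true, .snd)] []]
  | false, or _ _ =>
    [.step [(true, .self), (false, .fst)] [], .step [(true, .self), (false, .snd)] []]
  | true, next _ => [.step [(false, .self)] [(true, .fst)]]
  | false, next _ => [.step [(true, .self)] [(false, .fst)]]
  | true, always _ =>
    [.step [(false, .self)] [(true, .self)], .step [(false, .self), (true, .fst)] []]
  | false, always _ => [.ev [(true, .self)] (false, .fst)]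
  | true, eventually _ => [.ev [(false, .self)] (true, .fst)]
  | false, eventually _ =>
    [.step [(true, .self)] [(false, .self)], .step [(true, .self), (false, .fst)] []]
  | true, untl _ _ =>
    [.step [(false, .self), (true, .snd), (true, .fst)] [],
     .step [(false, .self), (true, .snd)] [(true, .self)],
     .ev [(false, .self)] (true, .snd)]
  | false, untl _ _ =>
    [.step [(true, .self), (false, .snd)] [],
     .step [(true, .self), (false, .fst)] [(false, .self)]]
  | true, release _ _ =>
    [.step [(false, .self), (true, .snd)] [],
     .step [(false, .self), (true, .fst)] [(true, .self)]]
  | false, release _ _ =>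
    [.step [(true, .self), (false, .snd), (false, .fst)] [],
     .step [(true, .self), (false, .snd)] [(false, .self)],
     .ev [(true, .self)] (false, .snd)]

/-- The clauses of the occurrence of `ψ` at position `p` with polarity `b`. -/
def nodeClauses (p : List Bool) (b : Bool) (ψ : LTL α) : List (Clause α) :=
  (schemes b ψ).filterMap (Scheme.inst (ψ.env p))

/-- The clauses of the occurrence of a subformula at position `p` with polarity `b`, and of all
occurrences below it. -/
def snfAux (p : List Bool) (b : Bool) : LTL α → List (Clause α)
  | tru | fls | atom _ => []
  | neg ψ => nodeClauses p b (neg ψ) ++ snfAux (p ++ [false]) (!b) ψ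
  | or ψ χ =>
    nodeClauses p b (or ψ χ) ++ snfAux (p ++ [false]) b ψ ++ snfAux (p ++ [true]) b χ
  | and ψ χ =>
    nodeClauses p b (and ψ χ) ++ snfAux (p ++ [false]) b ψ ++ snfAux (p ++ [true]) b χ
  | next ψ => nodeClauses p b (next ψ) ++ snfAux (p ++ [false]) b ψ
  | untl ψ χ =>
    nodeClauses p b (untl ψ χ) ++ snfAux (p ++ [false]) b ψ ++ snfAux (p ++ [true]) b χ
  | release ψ χ =>
    nodeClauses p b (release ψ χ) ++ snfAux (p ++ [false]) b ψ ++ snfAux (p ++ [true]) b χ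
  | eventually ψ => nodeClauses p b (eventually ψ) ++ snfAux (p ++ [false]) b ψ
  | always ψ => nodeClauses p b (always ψ) ++ snfAux (p ++ [false]) b ψ

/-- The SNF of `φ`: the initial clause `x_φ` together with the clauses of all occurrences of
subformulas of `φ`. -/
def snf (φ : LTL α) : Finset (Clause α) :=
  ((disj [(φ.ref []).signed true]).map Clause.initial).toFinset ∪ (snfAux [] true φ).toFinset

/-- Some clause of `C` is one of the clauses of the occurrence of `ψ` at position `p` with
polarity `b` in which the proposition of its immediate subformula occurrence `s` occurs. -/
def Uses (C : Set (Clause α)) (p : List Bool) (b : Bool) (ψ : LTL α) (s : Src) : Prop :=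
  ∃ r ∈ schemes b ψ, (∃ v, (v, s) ∈ r.lits) ∧ ∃ c ∈ C, r.inst (ψ.env p) = some c

open Classical in
/-- The occurrence of a subformula at position `p` with polarity `b`, with those occurrences of
proper subformulas replaced by `1` (positive polarity) or `0` (negative polarity) whose
propositions are not used by the clauses of their immediate superformula that are in `C`. -/
noncomputable def liftAux (C : Set (Clause α)) (p : List Bool) (b : Bool) : LTL α → LTL α
  | tru => tru
  | fls => fls
  | atom a => atom a
  | neg ψ =>
    neg (if Uses C p b (neg ψ) .fst then liftAux C (p ++ [false]) (!b) ψ else ofBool (!b))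
  | or ψ χ =>
    or (if Uses C p b (or ψ χ) .fst then liftAux C (p ++ [false]) b ψ else ofBool b)
      (if Uses C p b (or ψ χ) .snd then liftAux C (p ++ [true]) b χ else ofBool b)
  | and ψ χ =>
    and (if Uses C p b (and ψ χ) .fst then liftAux C (p ++ [false]) b ψ else ofBool b)
      (if Uses C p b (and ψ χ) .snd then liftAux C (p ++ [true]) b χ else ofBool b)
  | next ψ =>
    next (if Uses C p b (next ψ) .fst then liftAux C (p ++ [false]) b ψ else ofBool b)
  | untl ψ χ =>
    untl (if Uses C p b (untl ψ χ) .fst then liftAux C (p ++ [false]) b ψ else ofBool b)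
      (if Uses C p b (untl ψ χ) .snd then liftAux C (p ++ [true]) b χ else ofBool b)
  | release ψ χ =>
    release (if Uses C p b (release ψ χ) .fst then liftAux C (p ++ [false]) b ψ else ofBool b)
      (if Uses C p b (release ψ χ) .snd then liftAux C (p ++ [true]) b χ else ofBool b)
  | eventually ψ =>
    eventually (if Uses C p b (eventually ψ) .fst then liftAux C (p ++ [false]) b ψ else ofBool b)
  | always ψ =>
    always (if Uses C p b (always ψ) .fst then liftAux C (p ++ [false]) b ψ else ofBool b)

/-- The formula obtained by lifting a set `C` of clauses of the SNF of `φ` back to LTL. -/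
noncomputable def lift (C : Set (Clause α)) (φ : LTL α) : LTL α := liftAux C [] true φ

end LTL

end Translation

/-! ## Temporal resolution and its resolution graph -/

/-- A vertex is given by its partition (`none` for the main partition, `some i` for the
partition of the `i`-th loop search iteration) and the clause that it is labeled with; no
partition has two vertices with the same clause. -/
abbrev Vertex (α : Type*) := Option ℕ × Clause α

/-- A resolution graph under construction; `loops` is the number of loop search iterations
entered so far. -/
structure ResGraph (α : Type*) where
  verts : Set (Vertex α)
  edges : Set (Vertex α × Vertex α)
  loops : ℕ

namespace ResGraph

variable {α : Type*}

/-- The initial resolution graph for the set of starting clauses `C`. -/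
def start (C : Finset (Clause α)) : ResGraph α where
  verts := {v | v.1 = none ∧ v.2 ∈ C}
  edges := ∅
  loops := 0

/-- The clauses in a partition. -/
def part (G : ResGraph α) (k : Option ℕ) : Set (Clause α) := {c | (k, c) ∈ G.verts}

/-- The clauses in the main partition. -/
def main (G : ResGraph α) : Set (Clause α) := G.part none

/-- `G` with a new vertex for the clause `c` in partition `k` and edges from `S` to it. -/
def add (G : ResGraph α) (k : Option ℕ) (c : Clause α) (S : Set (Vertex α)) : ResGraph α where
  verts := insert (k, c) G.verts
  edges := G.edges ∪ {e | e.1 ∈ S ∧ e.2 = (k, c)}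
  loops := G.loops

/-- A new partition is created. -/
def newLoop (G : ResGraph α) : ResGraph α := { G with loops := G.loops + 1 }

def addEdges (G : ResGraph α) (S : Set (Vertex α × Vertex α)) : ResGraph α :=
  { G with edges := G.edges ∪ S }

/-- The disjunctions `P` such that `G (P)` is a global clause with empty `X` part in `k`. -/
def emptyX (G : ResGraph α) (k : Option ℕ) : Set (Finset (Lit α)) :=
  {P | Clause.global P ∅ ∈ G.part k}

def HasEmptyClause (G : ResGraph α) : Prop := ∃ c ∈ G.main, c.IsEmptyClause

/-- The unsatisfiable core in SNF: the starting clauses that label vertices of the main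
partition from which `v` can be reached. -/
def core (G : ResGraph α) (C : Finset (Clause α)) (v : Vertex α) : Set (Clause α) :=
  {c | c ∈ C ∧ (none, c) ∈ G.verts ∧
    Relation.ReflTransGen (fun u u' => (u, u') ∈ G.edges) (none, c) v}

end ResGraph

section TemporalResolution

variable {α : Type*} [DecidableEq α]

/-- `StepXX c₁ c₂ c`: rule step-xx derives `c` from `c₁` and `c₂`. -/
inductive StepXX : Clause α → Clause α → Clause α → Prop
  | mk (P Q R S : Finset (Lit α)) (l : Lit α) (h : l ∈ Q) (h' : l.neg ∈ S) :
    StepXX (.global P Q) (.global R S) (.global (P ∪ R) (Q.erase l ∪ S.erase l.neg))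

/-- The saturation rules. -/
inductive SatRule : Clause α → Clause α → Clause α → Prop
  | init_ii (P Q : Finset (Lit α)) (l : Lit α) (h : l ∈ P) (h' : l.neg ∈ Q) :
    SatRule (.initial P) (.initial Q) (.initial (P.erase l ∪ Q.erase l.neg))
  | init_in (P Q : Finset (Lit α)) (l : Lit α) (h : l ∈ P) (h' : l.neg ∈ Q) :
    SatRule (.initial P) (.global Q ∅) (.initial (P.erase l ∪ Q.erase l.neg))
  | step_nn (P Q : Finset (Lit α)) (l : Lit α) (h : l ∈ P) (h' : l.neg ∈ Q) :
    SatRule (.global P ∅) (.global Q ∅) (.global (P.erase l ∪ Q.erase l.neg) ∅)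
  | step_nx (P Q R : Finset (Lit α)) (l : Lit α) (h : l ∈ P) (h' : l.neg ∈ R) :
    SatRule (.global P ∅) (.global Q R) (.global Q (P.erase l ∪ R.erase l.neg))
  | step_xx (c₁ c₂ c : Clause α) (h : StepXX c₁ c₂ c) : SatRule c₁ c₂ c

/-- Application of a saturation rule in the main partition that generates a new clause. -/
def SatStep (G G' : ResGraph α) : Prop :=
  ∃ c₁ ∈ G.main, ∃ c₂ ∈ G.main, ∃ c, SatRule c₁ c₂ c ∧ c ∉ G.main ∧
    G' = G.add none c {(none, c₁), (none, c₂)}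

/-- Application of rule aug1 or aug2 that generates a new clause. For aug2, there is no edge
from the premise. -/
inductive AugStep (G : ResGraph α) : ResGraph α → Prop
  | aug1 (P : Finset (Lit α)) (l : Lit α) (h : .eventuality P l ∈ G.main)
    (hnew : .global (P ∪ {l, l.waitFor}) ∅ ∉ G.main) :
    AugStep G (G.add none (.global (P ∪ {l, l.waitFor}) ∅) {(none, .eventuality P l)})
  | aug2 (P : Finset (Lit α)) (l : Lit α) (h : .eventuality P l ∈ G.main)
    (hnew : .global {l.waitFor.neg} {l, l.waitFor} ∉ G.main) :
    AugStep G (G.add none (.global {l.waitFor.neg} {l, l.waitFor}) ∅)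

/-- Application of a rule that initializes the loop search iteration with partition `i` for the
eventuality literal `l`, and that generates a new clause. `C'` are the disjunctions of the global
clauses with empty `X` part from the previous iteration. For BFS-loop-it-init-c, there are no
edges from the premises. -/
inductive LoopInitStep (C' : Set (Finset (Lit α))) (l : Lit α) (i : ℕ) (G : ResGraph α) :
    ResGraph α → Prop
  | init_x (P Q : Finset (Lit α)) (h : .global P Q ∈ G.main) (hQ : Q.Nonempty)
    (hnew : .global P Q ∉ G.part (some i)) :
    LoopInitStep C' l i G (G.add (some i) (.global P Q) {(none, .global P Q)})
  | init_n (P : Finset (Lit α)) (h : .global P ∅ ∈ G.main)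
    (hnew : .global ∅ P ∉ G.part (some i)) :
    LoopInitStep C' l i G (G.add (some i) (.global ∅ P) {(none, .global P ∅)})
  | init_c (P : Finset (Lit α)) (h : P ∈ C')
    (hnew : .global ∅ (insert l P) ∉ G.part (some i)) :
    LoopInitStep C' l i G (G.add (some i) (.global ∅ (insert l P)) ∅)

/-- Application of rule step-xx in partition `i` that generates a new clause. -/
def LoopSatStep (i : ℕ) (G G' : ResGraph α) : Prop :=
  ∃ c₁ ∈ G.part (some i), ∃ c₂ ∈ G.part (some i), ∃ c, StepXX c₁ c₂ c ∧
    c ∉ G.part (some i) ∧ G' = G.add (some i) c {(some i, c₁), (some i, c₂)}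

/-- Application of rule BFS-loop-conclusion1 or BFS-loop-conclusion2 to a clause in partition `i`
and the eventuality clause `G (Q ∨ F l)` that generates a new clause. For
BFS-loop-conclusion2, there is no edge from the eventuality clause. -/
inductive LoopConclStep (Q : Finset (Lit α)) (l : Lit α) (i : ℕ) (G : ResGraph α) :
    ResGraph α → Prop
  | concl1 (P : Finset (Lit α)) (h : P ∈ G.emptyX (some i))
    (hnew : .global (P ∪ Q ∪ {l}) ∅ ∉ G.main) :
    LoopConclStep Q l i G (G.add none (.global (P ∪ Q ∪ {l}) ∅)
      {(some i, .global P ∅), (none, .eventuality Q l)})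
  | concl2 (P : Finset (Lit α)) (h : P ∈ G.emptyX (some i))
    (hnew : .global {l.waitFor.neg} (insert l P) ∉ G.main) :
    LoopConclStep Q l i G (G.add none (.global {l.waitFor.neg} (insert l P))
      {(some i, .global P ∅)})

/-- Steps are performed, in any order, until none is possible. -/
def Exhaust (step : ResGraph α → ResGraph α → Prop) (G G' : ResGraph α) : Prop :=
  Relation.ReflTransGen step G G' ∧ ∀ G'', ¬ step G' G''

/-- `P ∈ C'` subsumes `Q` if its literals are among those of `Q`. -/
def Subsumes (C' C'' : Set (Finset (Lit α))) : Prop := ∀ Q ∈ C'', ∃ P ∈ C', P ⊆ Q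

/-- The recorded applications of rule BFS-loop-it-sub: `(P, Q) ∈ D` if `P ∈ C'` is the first
clause that was found to subsume `Q ∈ C''`. -/
structure IsSubRecord (C' C'' : Set (Finset (Lit α)))
    (D : Set (Finset (Lit α) × Finset (Lit α))) : Prop where
  valid : ∀ P Q, (P, Q) ∈ D → P ∈ C' ∧ Q ∈ C'' ∧ P ⊆ Q
  unique : ∀ P P' Q, (P, Q) ∈ D → (P', Q) ∈ D → P = P'
  total : ∀ Q ∈ C'', (∃ P ∈ C', P ⊆ Q) → ∃ P, (P, Q) ∈ D

/-- One loop search iteration for the eventuality literal `l` with the set `C''` of clauses from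
the previous iteration, from `G` to `G'`. The new partition is `some G.loops`. -/
def LoopIteration (l : Lit α) (C'' : Set (Finset (Lit α))) (G G' : ResGraph α) : Prop :=
  ∃ G₁ G₂ D, Exhaust (LoopInitStep C'' l G.loops) G.newLoop G₁ ∧
    Exhaust (LoopSatStep G.loops) G₁ G₂ ∧
    IsSubRecord (G₂.emptyX (some G.loops)) C'' D ∧
    G' = G₂.addEdges {e | ∃ P Q, (P, Q) ∈ D ∧
      e = ((some G.loops, .global P ∅), (some G.loops, .global ∅ (insert l Q)))}

/-- `LoopSearch l C'' G r G'`: the repeat loop of a loop search for the eventuality literal `l`,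
entered with the set of clauses `C''`, leads from `G` to `G'`; `r` is the partition of the last
iteration if a loop has been found, and `none` otherwise. -/
inductive LoopSearch (l : Lit α) :
    Set (Finset (Lit α)) → ResGraph α → Option ℕ → ResGraph α → Prop
  | found (C'' : Set (Finset (Lit α))) (G G' : ResGraph α) (h : LoopIteration l C'' G G')
    (hs : Subsumes (G'.emptyX (some G.loops)) C'') : LoopSearch l C'' G (some G.loops) G'
  | notFound (C'' : Set (Finset (Lit α))) (G G' : ResGraph α) (h : LoopIteration l C'' G G')
    (hs : ¬ Subsumes (G'.emptyX (some G.loops)) C'') (he : G'.emptyX (some G.loops) = ∅) :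
    LoopSearch l C'' G none G'
  | again (C'' : Set (Finset (Lit α))) (G G' G'' : ResGraph α) (r : Option ℕ)
    (h : LoopIteration l C'' G G') (hs : ¬ Subsumes (G'.emptyX (some G.loops)) C'')
    (he : G'.emptyX (some G.loops) ≠ ∅)
    (hr : LoopSearch l (G'.emptyX (some G.loops)) G' r G'') : LoopSearch l C'' G r G''

inductive Outcome where
  | unsat
  | sat

/-- The for loop over the list of eventuality clauses still to be treated; the outcome is `none`
if it ends without returning. -/
inductive ForLoop : List (Clause α) → ResGraph α → Option Outcome → ResGraph α → Prop
  | done (G : ResGraph α) : ForLoop [] G none G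
  | notFound (Q : Finset (Lit α)) (l : Lit α) (L : List (Clause α)) (G G₁ G' : ResGraph α)
    (r : Option Outcome) (hl : LoopSearch l {∅} G none G₁) (hr : ForLoop L G₁ r G') :
    ForLoop (.eventuality Q l :: L) G r G'
  | foundUnsat (Q : Finset (Lit α)) (l : Lit α) (L : List (Clause α)) (i : ℕ)
    (G G₁ G₂ G' : ResGraph α) (hl : LoopSearch l {∅} G (some i) G₁)
    (hc : Exhaust (LoopConclStep Q l i) G₁ G₂) (hs : Exhaust SatStep G₂ G')
    (he : G'.HasEmptyClause) : ForLoop (.eventuality Q l :: L) G (some .unsat) G'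
  | foundContinue (Q : Finset (Lit α)) (l : Lit α) (L : List (Clause α)) (i : ℕ)
    (G G₁ G₂ G₃ G' : ResGraph α) (r : Option Outcome) (hl : LoopSearch l {∅} G (some i) G₁)
    (hc : Exhaust (LoopConclStep Q l i) G₁ G₂) (hs : Exhaust SatStep G₂ G₃)
    (he : ¬ G₃.HasEmptyClause) (hr : ForLoop L G₃ r G') :
    ForLoop (.eventuality Q l :: L) G r G'

/-- The while loop, where `M'` is the main partition at the previous test. -/
inductive WhileLoop (C : Finset (Clause α)) :
    Set (Clause α) → ResGraph α → Outcome → ResGraph α → Prop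
  | exit (M' : Set (Clause α)) (G : ResGraph α) (h : M' = G.main) : WhileLoop C M' G .sat G
  | ret (M' : Set (Clause α)) (G G' : ResGraph α) (L : List (Clause α)) (r : Outcome)
    (h : M' ≠ G.main) (hn : L.Nodup) (hL : ∀ c, c ∈ L ↔ c ∈ C ∧ c.IsEventuality)
    (hf : ForLoop L G (some r) G') : WhileLoop C M' G r G'
  | again (M' : Set (Clause α)) (G G₁ G' : ResGraph α) (L : List (Clause α)) (r : Outcome)
    (h : M' ≠ G.main) (hn : L.Nodup) (hL : ∀ c, c ∈ L ↔ c ∈ C ∧ c.IsEventuality)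
    (hf : ForLoop L G none G₁) (hr : WhileLoop C G.main G₁ r G') : WhileLoop C M' G r G'

/-- `TRRun C r G`: an execution of temporal resolution on the set of SNF clauses `C` terminates
with outcome `r` and with the resolution graph `G`. -/
inductive TRRun (C : Finset (Clause α)) : Outcome → ResGraph α → Prop
  | unsat₀ (h : (ResGraph.start C).HasEmptyClause) : TRRun C .unsat (ResGraph.start C)
  | unsat₁ (G : ResGraph α) (h₀ : ¬ (ResGraph.start C).HasEmptyClause)
    (h₁ : Exhaust SatStep (ResGraph.start C) G) (h : G.HasEmptyClause) : TRRun C .unsat G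
  | unsat₂ (G₁ G₂ G : ResGraph α) (h₀ : ¬ (ResGraph.start C).HasEmptyClause)
    (h₁ : Exhaust SatStep (ResGraph.start C) G₁) (he : ¬ G₁.HasEmptyClause)
    (h₂ : Exhaust AugStep G₁ G₂) (h₃ : Exhaust SatStep G₂ G) (h : G.HasEmptyClause) :
    TRRun C .unsat G
  | main (G₁ G₂ G₃ G : ResGraph α) (r : Outcome) (h₀ : ¬ (ResGraph.start C).HasEmptyClause)
    (h₁ : Exhaust SatStep (ResGraph.start C) G₁) (he₁ : ¬ G₁.HasEmptyClause)
    (h₂ : Exhaust AugStep G₁ G₂) (h₃ : Exhaust SatStep G₂ G₃) (he₃ : ¬ G₃.HasEmptyClause)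
    (h : WhileLoop C ∅ G₃ r G) : TRRun C r G

/-- `C'` is an unsatisfiable core in SNF of `C`, obtained from an execution of temporal resolution
on `C` that shows unsatisfiability by backward traversal of the resolution graph from a vertex
of the main partition that is labeled with the empty clause. -/
def IsCoreInSNF (C : Finset (Clause α)) (C' : Set (Clause α)) : Prop :=
  ∃ G : ResGraph α, TRRun C .unsat G ∧
    ∃ c, (none, c) ∈ G.verts ∧ c.IsEmptyClause ∧ C' = G.core C (none, c)

/-- `φ'` is an unsatisfiable core in LTL of `φ`. -/
def IsCoreInLTL (φ φ' : LTL α) : Prop :=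
  ∃ C' : Set (Clause α), IsCoreInSNF φ.snf C' ∧ φ' = φ.lift C'

end TemporalResolution


/-!
Read each "wait for" proposition `w_l` as `X F l`. Then every clause `c` of the main partition is
implied by its own core, that is, by the starting clauses from which the vertex of `c` can be
reached; for `c = □` this says that the core in SNF is unsatisfiable. The missing edges (from the
premise of aug2 and of BFS-loop-it-init-c, and from the eventuality clause in
BFS-loop-conclusion2) do no harm. The clauses added by aug2 are valid under the above reading. In a
loop search partition, a clause whose core holds can only fail at time `t` if one of its ancestors
`G (X (R ∨ l))` with `R ∈ C''` does. If a loop has been found, then each such `R` is subsumed by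
some `P` with an edge from `G (P)` to `G (X (R ∨ l))`, so `l` and `P` fail at time `t + 1`, and the
core of `G (P)` is contained in that of the clause that failed at time `t`. By induction `l` never
holds after time `t`, so `G (P ∨ ¬ X F l)` follows from the core of each `G (P)` in the partition.

A model of the lifted formula becomes a model of the core in SNF when the proposition of each
occurrence of a subformula is interpreted by the lifted occurrence: a subformula occurrence whose
proposition appears in a clause of the core is used there and thus has not been replaced, so that
the clause is a clause of the translation of the lifted formula.
-/

/-! ## Semantics of SNF clauses -/

theorem exists_ge_iff_or_exists_gt {p : ℕ → Prop} {t : ℕ} :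
    (∃ k, t ≤ k ∧ p k) ↔ p t ∨ ∃ k, t < k ∧ p k := by
  simp only [le_iff_eq_or_lt (a := t), or_and_right, exists_or, exists_eq_left']

section Semantics

variable {α : Type*}

/-- The literal `l` holds at time `t` of the infinite word `w`. -/
def Lit.Holds (w : ℕ → Set (SAtom α)) (l : Lit α) (t : ℕ) : Prop :=
  l.var ∈ w t ↔ l.sign = true

/-- The disjunction of the literals in `P` holds at time `t` of the infinite word `w`. -/
def DisjHolds (w : ℕ → Set (SAtom α)) (P : Finset (Lit α)) (t : ℕ) : Prop :=
  ∃ l ∈ P, l.Holds w t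

/-- What the clause says about time `t` of the infinite word `w`: the formula below `G` holds at
time `t`. An initial clause always speaks about time `0`. -/
def Clause.HoldsAt (w : ℕ → Set (SAtom α)) : Clause α → ℕ → Prop
  | .initial P, _ => DisjHolds w P 0
  | .global P Q, t => DisjHolds w P t ∨ DisjHolds w Q (t + 1)
  | .eventuality P l, t => DisjHolds w P t ∨ ∃ k, t ≤ k ∧ l.Holds w k

/-- The clause is satisfied by the infinite word `w`. -/
def Clause.Valid (w : ℕ → Set (SAtom α)) (c : Clause α) : Prop := ∀ t, c.HoldsAt w t

/-- The "wait for" proposition of each literal `l` has the truth value of `X F l`. -/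
def InterpretsWaitFor (w : ℕ → Set (SAtom α)) : Prop :=
  ∀ (l : Lit α) (t : ℕ), l.waitFor.Holds w t ↔ ∃ k, t < k ∧ l.Holds w k

/-- Satisfiability of a set of SNF clauses. The "wait for" propositions, which are meant to be
fresh, are required to have their intended interpretation. -/
def SNFSatisfiable (C : Set (Clause α)) : Prop :=
  ∃ w : ℕ → Set (SAtom α), InterpretsWaitFor w ∧ ∀ c ∈ C, c.Valid w

variable {w : ℕ → Set (SAtom α)} {t : ℕ} {l : Lit α} {P Q : Finset (Lit α)}

theorem Lit.holds_neg : l.neg.Holds w t ↔ ¬ l.Holds w t := by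
  rcases l with ⟨_ | _, p⟩ <;> simp [Lit.neg, Lit.Holds]

theorem DisjHolds.mono (h : DisjHolds w P t) (hPQ : P ⊆ Q) : DisjHolds w Q t :=
  let ⟨l, hl, h⟩ := h
  ⟨l, hPQ hl, h⟩

@[simp]
theorem not_disjHolds_empty : ¬ DisjHolds w ∅ t := by
  simp [DisjHolds]

@[simp]
theorem disjHolds_singleton : DisjHolds w {l} t ↔ l.Holds w t := by
  simp [DisjHolds]

@[simp]
theorem Clause.holdsAt_global_empty_right :
    (Clause.global P ∅).HoldsAt w t ↔ DisjHolds w P t := by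
  simp [Clause.HoldsAt]

@[simp]
theorem Clause.holdsAt_global_empty_left :
    (Clause.global ∅ P).HoldsAt w t ↔ DisjHolds w P (t + 1) := by
  simp [Clause.HoldsAt]

theorem Clause.IsEmptyClause.not_valid {c : Clause α} (hc : c.IsEmptyClause) : ¬ c.Valid w := by
  intro h
  rcases hc with rfl | rfl
  · exact not_disjHolds_empty (h 0)
  · exact not_disjHolds_empty (Clause.holdsAt_global_empty_right.1 (h 0))

namespace InterpretsWaitFor

theorem exists_ge_holds_iff (hw : InterpretsWaitFor w) :
    (∃ k, t ≤ k ∧ l.Holds w k) ↔ l.Holds w t ∨ l.waitFor.Holds w t := by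
  rw [hw, exists_ge_iff_or_exists_gt]

theorem holds_waitFor_iff (hw : InterpretsWaitFor w) :
    l.waitFor.Holds w t ↔ l.Holds w (t + 1) ∨ l.waitFor.Holds w (t + 1) :=
  (hw l t).trans hw.exists_ge_holds_iff

end InterpretsWaitFor

variable [DecidableEq α]

@[simp]
theorem disjHolds_union : DisjHolds w (P ∪ Q) t ↔ DisjHolds w P t ∨ DisjHolds w Q t := by
  simp only [DisjHolds, Finset.mem_union, or_and_right, exists_or]

@[simp]
theorem disjHolds_insert : DisjHolds w (insert l P) t ↔ l.Holds w t ∨ DisjHolds w P t := by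
  simp [DisjHolds]

theorem DisjHolds.resolvent (hP : DisjHolds w P t) (hQ : DisjHolds w Q t) (l : Lit α) :
    DisjHolds w (P.erase l ∪ Q.erase l.neg) t := by
  obtain ⟨a, haP, ha⟩ := hP
  obtain ⟨b, hbQ, hb⟩ := hQ
  by_cases hl : l.Holds w t
  · have hbl : b ≠ l.neg := by
      rintro rfl
      exact Lit.holds_neg.1 hb hl
    exact ⟨b, Finset.mem_union_right _ (Finset.mem_erase.2 ⟨hbl, hbQ⟩), hb⟩
  · have hal : a ≠ l := by
      rintro rfl
      exact hl ha
    exact ⟨a, Finset.mem_union_left _ (Finset.mem_erase.2 ⟨hal, haP⟩), ha⟩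

theorem StepXX.holdsAt {c₁ c₂ c : Clause α} (h : StepXX c₁ c₂ c) (h₁ : c₁.HoldsAt w t)
    (h₂ : c₂.HoldsAt w t) : c.HoldsAt w t := by
  obtain ⟨P, Q, R, S, l, -, -⟩ := h
  rcases h₁ with hP | hQ
  · exact .inl (disjHolds_union.2 (.inl hP))
  rcases h₂ with hR | hS
  · exact .inl (disjHolds_union.2 (.inr hR))
  · exact .inr (hQ.resolvent hS l)

theorem SatRule.valid {c₁ c₂ c : Clause α} (h : SatRule c₁ c₂ c) (h₁ : c₁.Valid w)
    (h₂ : c₂.Valid w) : c.Valid w := by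
  intro t
  cases h with
  | init_ii P Q l => exact (h₁ t).resolvent (h₂ t) l
  | init_in P Q l => exact (h₁ t).resolvent (Clause.holdsAt_global_empty_right.1 (h₂ 0)) l
  | step_nn P Q l =>
    have hP := Clause.holdsAt_global_empty_right.1 (h₁ t)
    have hQ := Clause.holdsAt_global_empty_right.1 (h₂ t)
    exact Clause.holdsAt_global_empty_right.2 (hP.resolvent hQ l)
  | step_nx P Q R l =>
    have hP := Clause.holdsAt_global_empty_right.1 (h₁ (t + 1))
    exact (h₂ t).imp_right fun hR => hP.resolvent hR l
  | step_xx _ _ _ h => exact h.holdsAt (h₁ t) (h₂ t)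

end Semantics

/-! ## Soundness of temporal resolution relative to cores -/

section Soundness

variable {α : Type*}

namespace ResGraph

/-- The vertex `u'` can be reached from `u` along the edges of `G`. -/
def Reaches (G : ResGraph α) (u u' : Vertex α) : Prop :=
  Relation.ReflTransGen (fun u u' => (u, u') ∈ G.edges) u u'

/-- The infinite word `w` satisfies the core of the vertex `u`, when `C` are the starting
clauses. -/
def CoreValid (G : ResGraph α) (C : Finset (Clause α)) (w : ℕ → Set (SAtom α))
    (u : Vertex α) : Prop :=
  ∀ c ∈ G.core C u, c.Valid w

variable {G G' : ResGraph α} {C : Finset (Clause α)} {w : ℕ → Set (SAtom α)} {u u' : Vertex α}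
  {k : Option ℕ} {c : Clause α} {S : Set (Vertex α)}

theorem mem_part_add {k' : Option ℕ} {c' : Clause α} :
    c' ∈ (G.add k c S).part k' ↔ (k' = k ∧ c' = c) ∨ c' ∈ G.part k' := by
  simp [part, add]

theorem verts_subset_add : G.verts ⊆ (G.add k c S).verts := Set.subset_insert _ _

theorem edges_subset_add : G.edges ⊆ (G.add k c S).edges := Set.subset_union_left

theorem Reaches.mono (h : G.Reaches u u') (hE : G.edges ⊆ G'.edges) : G'.Reaches u u' :=
  Relation.ReflTransGen.mono (fun _ _ he => hE he) _ _ h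

theorem Reaches.add (h : G.Reaches u u') (hu' : u' ∈ S) :
    (G.add k c S).Reaches u (k, c) :=
  (h.mono edges_subset_add).tail (.inr ⟨hu', rfl⟩)

theorem CoreValid.of_subset (h : G'.CoreValid C w u) (hV : G.verts ⊆ G'.verts)
    (hE : G.edges ⊆ G'.edges) : G.CoreValid C w u :=
  fun c ⟨hcC, hcV, hcu⟩ => h c ⟨hcC, hV hcV, Reaches.mono hcu hE⟩

theorem CoreValid.of_reaches (h : G.CoreValid C w u') (hu : G.Reaches u u') :
    G.CoreValid C w u :=
  fun c ⟨hcC, hcV, hcu⟩ => h c ⟨hcC, hcV, hcu.trans hu⟩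

theorem CoreValid.of_add (h : (G.add k c S).CoreValid C w u) : G.CoreValid C w u :=
  h.of_subset verts_subset_add edges_subset_add

theorem CoreValid.of_mem_premises (h : (G.add k c S).CoreValid C w (k, c)) (hu : u ∈ S) :
    G.CoreValid C w u :=
  (h.of_reaches (Reaches.add .refl hu)).of_add

/-- The invariant of temporal resolution on the starting clauses `C`: each clause of the main
partition holds in `w` if its core does. The bound on the indices of the loop search partitions
ensures that the next one is new. -/
structure Sound (G : ResGraph α) (C : Finset (Clause α)) (w : ℕ → Set (SAtom α)) : Prop where
  subset_main : ∀ c ∈ C, c ∈ G.main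
  valid : ∀ c ∈ G.main, G.CoreValid C w (none, c) → c.Valid w
  lt_loops : ∀ i, ∀ c ∈ G.part (some i), i < G.loops

/-- A starting clause `G (X (R ∨ l))` of the loop search partition `i`, where `R ∈ C''`, is an
ancestor of the clause `c` in that partition and fails at time `t` of `w`. -/
def PremiseFails (G : ResGraph α) [DecidableEq α] (w : ℕ → Set (SAtom α))
    (C'' : Set (Finset (Lit α))) (l : Lit α) (i : ℕ) (c : Clause α) (t : ℕ) : Prop :=
  ∃ R ∈ C'', G.Reaches (some i, .global ∅ (insert l R)) (some i, c) ∧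
    ¬ DisjHolds w (insert l R) (t + 1)

/-- The invariant of a loop search iteration in partition `i` for the eventuality literal `l`,
where `C''` comes from the previous iteration: a clause of the partition whose core holds in `w`
fails only where a clause that stems from `C''` does. -/
structure LoopSound (G : ResGraph α) [DecidableEq α] (C : Finset (Clause α))
    (w : ℕ → Set (SAtom α)) (C'' : Set (Finset (Lit α))) (l : Lit α) (i : ℕ) : Prop
    extends Sound G C w where
  lt : i < G.loops
  holdsAt : ∀ c ∈ G.part (some i), G.CoreValid C w (some i, c) →
    ∀ t, c.HoldsAt w t ∨ G.PremiseFails w C'' l i c t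

/-- The invariant after a loop has been found in partition `i` for the eventuality literal `l`:
`G (P ∨ ¬ X F l)` holds in `w` for each clause `G (P)` of the partition whose core does. -/
structure FoundSound (G : ResGraph α) (C : Finset (Clause α)) (w : ℕ → Set (SAtom α))
    (l : Lit α) (i : ℕ) : Prop extends Sound G C w where
  disjHolds_of_waitFor : ∀ P ∈ G.emptyX (some i), G.CoreValid C w (some i, .global P ∅) →
    ∀ t, l.waitFor.Holds w t → DisjHolds w P t

theorem sound_start : (start C).Sound C w where
  subset_main _ hc := ⟨rfl, hc⟩
  valid c hc h := h c ⟨hc.2, hc, .refl⟩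
  lt_loops _ _ hc := nomatch hc.1

theorem Sound.newLoop (hG : G.Sound C w) : G.newLoop.Sound C w where
  subset_main := hG.subset_main
  valid := hG.valid
  lt_loops i c hc := (hG.lt_loops i c hc).trans (Nat.lt_succ_self _)

theorem Sound.addEdges {S : Set (Vertex α × Vertex α)} (hG : G.Sound C w) :
    (G.addEdges S).Sound C w where
  subset_main := hG.subset_main
  valid c hc h := hG.valid c hc (h.of_subset subset_rfl Set.subset_union_left)
  lt_loops := hG.lt_loops

theorem Sound.add_main (hG : G.Sound C w)
    (hc : (∀ u ∈ S, G.CoreValid C w u) → c.Valid w) : (G.add none c S).Sound C w where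
  subset_main c' hc' := mem_part_add.2 (.inr (hG.subset_main c' hc'))
  valid c' hc' h := by
    rcases mem_part_add.1 hc' with ⟨-, rfl⟩ | hc'
    · exact hc fun u hu => h.of_mem_premises hu
    · exact hG.valid c' hc' h.of_add
  lt_loops i c' hc' := hG.lt_loops i c' ((mem_part_add.1 hc').resolve_left nofun)

theorem Sound.add_loop {i : ℕ} (hG : G.Sound C w) (hi : i < G.loops) :
    (G.add (some i) c S).Sound C w where
  subset_main c' hc' := mem_part_add.2 (.inr (hG.subset_main c' hc'))
  valid c' hc' h := hG.valid c' ((mem_part_add.1 hc').resolve_left nofun) h.of_add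
  lt_loops j c' hc' := by
    rcases mem_part_add.1 hc' with ⟨hj, -⟩ | hc'
    · exact (Option.some.inj hj).trans_lt hi
    · exact hG.lt_loops j c' hc'

theorem FoundSound.add_main {l : Lit α} {i : ℕ} (hG : G.FoundSound C w l i)
    (hc : (∀ u ∈ S, G.CoreValid C w u) → c.Valid w) :
    (G.add none c S).FoundSound C w l i where
  toSound := hG.toSound.add_main hc
  disjHolds_of_waitFor P hP h := by
    have hP : .global P ∅ ∈ (G.add none c S).part (some i) := hP
    exact hG.disjHolds_of_waitFor P ((mem_part_add.1 hP).resolve_left nofun) h.of_add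

variable [DecidableEq α] {C'' : Set (Finset (Lit α))} {l : Lit α} {i : ℕ} {t : ℕ}

theorem PremiseFails.mono (h : G.PremiseFails w C'' l i c t) (hE : G.edges ⊆ G'.edges) :
    G'.PremiseFails w C'' l i c t :=
  let ⟨R, hR, hRc, hRt⟩ := h
  ⟨R, hR, hRc.mono hE, hRt⟩

theorem PremiseFails.add {c' : Clause α} (h : G.PremiseFails w C'' l i c t)
    (hc : (some i, c) ∈ S) : (G.add (some i) c' S).PremiseFails w C'' l i c' t :=
  let ⟨R, hR, hRc, hRt⟩ := h
  ⟨R, hR, hRc.add hc, hRt⟩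

theorem Sound.loopSound_newLoop (hG : G.Sound C w) :
    G.newLoop.LoopSound C w C'' l G.loops where
  toSound := hG.newLoop
  lt := Nat.lt_succ_self _
  holdsAt c hc := absurd (hG.lt_loops _ c hc) (lt_irrefl _)

theorem LoopSound.addEdges {S : Set (Vertex α × Vertex α)} (hG : G.LoopSound C w C'' l i) :
    (G.addEdges S).LoopSound C w C'' l i where
  toSound := hG.toSound.addEdges
  lt := hG.lt
  holdsAt c hc h t :=
    (hG.holdsAt c hc (h.of_subset subset_rfl Set.subset_union_left) t).imp_right
      fun h => h.mono Set.subset_union_left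

theorem LoopSound.add (hG : G.LoopSound C w C'' l i)
    (hc : (∀ u ∈ S, G.CoreValid C w u) →
      ∀ t, c.HoldsAt w t ∨ (G.add (some i) c S).PremiseFails w C'' l i c t) :
    (G.add (some i) c S).LoopSound C w C'' l i where
  toSound := hG.toSound.add_loop hG.lt
  lt := hG.lt
  holdsAt c' hc' h t := by
    rcases mem_part_add.1 hc' with ⟨-, rfl⟩ | hc'
    · exact hc (fun u hu => h.of_mem_premises hu) t
    · exact (hG.holdsAt c' hc' h.of_add t).imp_right fun h => h.mono edges_subset_add

theorem LoopSound.foundSound (hw : InterpretsWaitFor w) (hG : G.LoopSound C w C'' l i)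
    (hsub : ∀ R ∈ C'', ∃ P ∈ G.emptyX (some i), P ⊆ R ∧
      ((some i, .global P ∅), (some i, .global ∅ (insert l R))) ∈ G.edges) :
    G.FoundSound C w l i where
  toSound := hG.toSound
  disjHolds_of_waitFor P hP hPC t hwait := by
    let Fails (k : ℕ) : Prop := ∃ P ∈ G.emptyX (some i),
      G.CoreValid C w (some i, .global P ∅) ∧ ¬ DisjHolds w P k
    have fails_succ {k : ℕ} (hk : Fails k) : ¬ l.Holds w (k + 1) ∧ Fails (k + 1) := by
      obtain ⟨P, hP, hPC, hPk⟩ := hk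
      obtain ⟨R, hR, hRP, hRk⟩ := (hG.holdsAt _ hP hPC k).resolve_left
        (mt Clause.holdsAt_global_empty_right.1 hPk)
      obtain ⟨P', hP', hP'R, hedge⟩ := hsub R hR
      rw [disjHolds_insert, not_or] at hRk
      exact ⟨hRk.1, P', hP', hPC.of_reaches (.head hedge hRP), fun h => hRk.2 (h.mono hP'R)⟩
    by_contra hPt
    have fails_of_ge {k : ℕ} (hk : t ≤ k) : Fails k := by
      induction k, hk using Nat.le_induction with
      | base => exact ⟨P, hP, hPC, hPt⟩
      | succ k _ ih => exact (fails_succ ih).2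
    obtain ⟨k, htk, hlk⟩ := (hw l t).1 hwait
    obtain ⟨k, rfl⟩ := Nat.exists_eq_succ_of_ne_zero (Nat.ne_zero_of_lt htk)
    exact (fails_succ (fails_of_ge (Nat.le_of_lt_succ htk))).1 hlk

end ResGraph

variable {C : Finset (Clause α)} {w : ℕ → Set (SAtom α)} {G G' : ResGraph α}

theorem Exhaust.invariant {step : ResGraph α → ResGraph α → Prop} {I : ResGraph α → Prop}
    (h : Exhaust step G G') (hstep : ∀ {G G'}, step G G' → I G → I G') (hI : I G) : I G' := by
  obtain ⟨hsteps, -⟩ := h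
  induction hsteps with
  | refl => exact hI
  | tail _ h ih => exact hstep h ih

variable [DecidableEq α]

theorem SatStep.sound (h : SatStep G G') (hG : G.Sound C w) : G'.Sound C w := by
  obtain ⟨c₁, h₁, c₂, h₂, c, hc, -, rfl⟩ := h
  exact hG.add_main fun hS =>
    hc.valid (hG.valid c₁ h₁ (hS _ (.inl rfl))) (hG.valid c₂ h₂ (hS _ (.inr rfl)))

theorem AugStep.sound (hw : InterpretsWaitFor w) (h : AugStep G G') (hG : G.Sound C w) :
    G'.Sound C w := by
  cases h with
  | aug1 P l h =>
    refine hG.add_main fun hS t => ?_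
    have hPl : DisjHolds w P t ∨ ∃ k, t ≤ k ∧ l.Holds w k := hG.valid _ h (hS _ rfl) t
    rw [hw.exists_ge_holds_iff] at hPl
    simpa only [Clause.holdsAt_global_empty_right, disjHolds_union, disjHolds_insert,
      disjHolds_singleton] using hPl
  | aug2 P l h =>
    refine hG.add_main fun _ t => ?_
    simpa [Clause.HoldsAt, Lit.holds_neg, imp_iff_not_or] using hw.holds_waitFor_iff.1

theorem LoopInitStep.loopSound {C'' : Set (Finset (Lit α))} {l : Lit α} {i : ℕ}
    (h : LoopInitStep C'' l i G G') (hG : G.LoopSound C w C'' l i) :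
    G'.LoopSound C w C'' l i := by
  cases h with
  | init_x P Q h => exact hG.add fun hS t => .inl (hG.valid _ h (hS _ rfl) t)
  | init_n P h =>
    refine hG.add fun hS t => .inl (Clause.holdsAt_global_empty_left.2 ?_)
    exact Clause.holdsAt_global_empty_right.1 (hG.valid _ h (hS _ rfl) (t + 1))
  | init_c P h =>
    refine hG.add fun _ t => or_iff_not_imp_left.2 fun hP => ?_
    exact ⟨P, h, .refl, mt Clause.holdsAt_global_empty_left.2 hP⟩

theorem LoopSatStep.loopSound {C'' : Set (Finset (Lit α))} {l : Lit α} {i : ℕ}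
    (h : LoopSatStep i G G') (hG : G.LoopSound C w C'' l i) : G'.LoopSound C w C'' l i := by
  obtain ⟨c₁, h₁, c₂, h₂, c, hc, -, rfl⟩ := h
  refine hG.add fun hS t => ?_
  rcases hG.holdsAt c₁ h₁ (hS _ (.inl rfl)) t with hc₁ | hfail
  · rcases hG.holdsAt c₂ h₂ (hS _ (.inr rfl)) t with hc₂ | hfail
    · exact .inl (hc.holdsAt hc₁ hc₂)
    · exact .inr (hfail.add (.inr rfl))
  · exact .inr (hfail.add (.inl rfl))

namespace LoopIteration

variable {C'' : Set (Finset (Lit α))} {l : Lit α}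

theorem loopSound (h : LoopIteration l C'' G G') (hG : G.Sound C w) :
    G'.LoopSound C w C'' l G.loops := by
  obtain ⟨G₁, G₂, D, hinit, hsat, -, rfl⟩ := h
  have hG₁ : G₁.LoopSound C w C'' l G.loops :=
    hinit.invariant LoopInitStep.loopSound hG.loopSound_newLoop
  have hG₂ : G₂.LoopSound C w C'' l G.loops := hsat.invariant LoopSatStep.loopSound hG₁
  exact hG₂.addEdges

theorem exists_edge_of_subsumes (h : LoopIteration l C'' G G')
    (hs : Subsumes (G'.emptyX (some G.loops)) C'') :
    ∀ R ∈ C'', ∃ P ∈ G'.emptyX (some G.loops), P ⊆ R ∧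
      ((some G.loops, .global P ∅), (some G.loops, .global ∅ (insert l R))) ∈ G'.edges := by
  obtain ⟨G₁, G₂, D, -, -, hD, rfl⟩ := h
  intro R hR
  obtain ⟨P, hPR⟩ := hD.total R hR (hs R hR)
  obtain ⟨hP, -, hsub⟩ := hD.valid P R hPR
  exact ⟨P, hP, hsub, .inr ⟨P, R, hPR, rfl⟩⟩

end LoopIteration

namespace LoopSearch

variable {C'' : Set (Finset (Lit α))} {l : Lit α} {r : Option ℕ} {i : ℕ}

theorem sound (h : LoopSearch l C'' G r G') (hG : G.Sound C w) : G'.Sound C w := by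
  induction h with
  | found _ _ _ h => exact (h.loopSound hG).toSound
  | notFound _ _ _ h => exact (h.loopSound hG).toSound
  | again _ _ _ _ _ h _ _ _ ih => exact ih (h.loopSound hG).toSound

theorem foundSound (hw : InterpretsWaitFor w) (h : LoopSearch l C'' G (some i) G')
    (hG : G.Sound C w) : G'.FoundSound C w l i := by
  generalize hr : some i = r at h
  induction h with
  | found _ _ _ h hs =>
    obtain rfl := Option.some.inj hr
    exact (h.loopSound hG).foundSound hw (h.exists_edge_of_subsumes hs)
  | notFound => cases hr
  | again _ _ _ _ _ h _ _ _ ih => exact ih (h.loopSound hG).toSound hr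

end LoopSearch

theorem LoopConclStep.foundSound {Q : Finset (Lit α)} {l : Lit α} {i : ℕ}
    (hw : InterpretsWaitFor w) (hQ : .eventuality Q l ∈ C) (h : LoopConclStep Q l i G G')
    (hG : G.FoundSound C w l i) : G'.FoundSound C w l i := by
  cases h with
  | concl1 P h =>
    refine hG.add_main fun hS t => ?_
    have hP : l.waitFor.Holds w t → DisjHolds w P t :=
      hG.disjHolds_of_waitFor P h (hS _ (.inl rfl)) t
    have hQl : DisjHolds w Q t ∨ ∃ k, t ≤ k ∧ l.Holds w k :=
      hG.valid _ (hG.subset_main _ hQ) (hS _ (.inr rfl)) t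
    rw [hw.exists_ge_holds_iff] at hQl
    simp only [Clause.holdsAt_global_empty_right, disjHolds_union, disjHolds_singleton]
    tauto
  | concl2 P h =>
    refine hG.add_main fun hS t => ?_
    have hP : l.waitFor.Holds w (t + 1) → DisjHolds w P (t + 1) :=
      hG.disjHolds_of_waitFor P h (hS _ rfl) (t + 1)
    simp only [Clause.HoldsAt, disjHolds_insert, disjHolds_singleton, Lit.holds_neg,
      hw.holds_waitFor_iff (t := t)]
    tauto

theorem LoopSearch.sound_conclusions {Q : Finset (Lit α)} {l : Lit α} {i : ℕ}
    {G₁ G₂ : ResGraph α} {C'' : Set (Finset (Lit α))} (hw : InterpretsWaitFor w)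
    (hQ : .eventuality Q l ∈ C) (hl : LoopSearch l C'' G (some i) G₁)
    (hc : Exhaust (LoopConclStep Q l i) G₁ G₂) (hs : Exhaust SatStep G₂ G') (hG : G.Sound C w) :
    G'.Sound C w := by
  have hG₂ : G₂.FoundSound C w l i :=
    hc.invariant (LoopConclStep.foundSound hw hQ) (hl.foundSound hw hG)
  exact hs.invariant SatStep.sound hG₂.toSound

theorem ForLoop.sound {L : List (Clause α)} {r : Option Outcome} (hw : InterpretsWaitFor w)
    (h : ForLoop L G r G') (hL : ∀ c ∈ L, c ∈ C) (hG : G.Sound C w) : G'.Sound C w := by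
  induction h with
  | done => exact hG
  | notFound _ _ _ _ _ _ _ hl _ ih => exact ih (List.forall_mem_cons.1 hL).2 (hl.sound hG)
  | foundUnsat _ _ _ _ _ _ _ _ hl hc hs =>
    exact hl.sound_conclusions hw (List.forall_mem_cons.1 hL).1 hc hs hG
  | foundContinue _ _ _ _ _ _ _ _ _ _ hl hc hs _ _ ih =>
    obtain ⟨hQ, hL⟩ := List.forall_mem_cons.1 hL
    exact ih hL (hl.sound_conclusions hw hQ hc hs hG)

theorem WhileLoop.sound {M' : Set (Clause α)} {r : Outcome} (hw : InterpretsWaitFor w)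
    (h : WhileLoop C M' G r G') (hG : G.Sound C w) : G'.Sound C w := by
  induction h with
  | exit => exact hG
  | ret _ _ _ _ _ _ _ hL hf => exact hf.sound hw (fun c hc => ((hL c).1 hc).1) hG
  | again _ _ _ _ _ _ _ _ hL hf _ ih => exact ih (hf.sound hw (fun c hc => ((hL c).1 hc).1) hG)

theorem TRRun.sound {r : Outcome} (hw : InterpretsWaitFor w) (h : TRRun C r G) :
    G.Sound C w := by
  have sound_sat {G G' : ResGraph α} (h : Exhaust SatStep G G') (hG : G.Sound C w) :
      G'.Sound C w := h.invariant SatStep.sound hG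
  have sound_aug {G G' : ResGraph α} (h : Exhaust AugStep G G') (hG : G.Sound C w) :
      G'.Sound C w := h.invariant (AugStep.sound hw) hG
  have sound_start : (ResGraph.start C).Sound C w := ResGraph.sound_start
  cases h with
  | unsat₀ => exact sound_start
  | unsat₁ _ _ h₁ => exact sound_sat h₁ sound_start
  | unsat₂ _ _ _ _ h₁ _ h₂ h₃ => exact sound_sat h₃ (sound_aug h₂ (sound_sat h₁ sound_start))
  | main _ _ _ _ _ _ h₁ _ h₂ h₃ _ h =>
    exact h.sound hw (sound_sat h₃ (sound_aug h₂ (sound_sat h₁ sound_start)))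

namespace IsCoreInSNF

variable {C' : Set (Clause α)}

theorem subset (h : IsCoreInSNF C C') : C' ⊆ C := by
  obtain ⟨G, -, c, -, -, rfl⟩ := h
  exact fun _ hc => hc.1

theorem not_snfSatisfiable (h : IsCoreInSNF C C') : ¬ SNFSatisfiable C' := by
  obtain ⟨G, hrun, c, hc, hempty, rfl⟩ := h
  rintro ⟨w, hw, hcore⟩
  exact hempty.not_valid ((hrun.sound hw).valid c hc hcore)

end IsCoreInSNF

end Soundness

/-! ## Models of lifted formulas -/

namespace LTL

variable {α : Type*} {w : ℕ → Set α} {ψ χ : LTL α} {t : ℕ}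

theorem holds_eventually_iff :
    (eventually ψ).Holds w t ↔ ψ.Holds w t ∨ (eventually ψ).Holds w (t + 1) :=
  exists_ge_iff_or_exists_gt

theorem holds_always_iff :
    (always ψ).Holds w t ↔ ψ.Holds w t ∧ (always ψ).Holds w (t + 1) := by
  simp only [Holds, Nat.succ_le_iff, le_iff_eq_or_lt (a := t), or_imp, forall_and, forall_eq']

theorem holds_untl_iff :
    (untl ψ χ).Holds w t ↔ χ.Holds w t ∨ ψ.Holds w t ∧ (untl ψ χ).Holds w (t + 1) := by
  constructor
  · rintro ⟨k, hk, hχ, hψ⟩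
    rcases hk.eq_or_lt with rfl | hk
    · exact .inl hχ
    · exact .inr ⟨hψ t le_rfl hk, k, hk, hχ, fun j hj => hψ j (by omega)⟩
  · rintro (hχ | ⟨hψ, k, hk, hχ, hψ'⟩)
    · exact ⟨t, le_rfl, hχ, fun j hj hj' => by omega⟩
    · refine ⟨k, by omega, hχ, fun j hj hj' => ?_⟩
      rcases hj.eq_or_lt with rfl | hj
      · exact hψ
      · exact hψ' j hj hj'

theorem not_holds_release_iff :
    ¬ (release ψ χ).Holds w t ↔ (untl (neg ψ) (neg χ)).Holds w t := by
  simp only [Holds, not_forall, not_or, not_exists, not_and, exists_prop]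

theorem holds_release_iff :
    (release ψ χ).Holds w t ↔
      χ.Holds w t ∧ (ψ.Holds w t ∨ (release ψ χ).Holds w (t + 1)) := by
  rw [← not_iff_not, not_holds_release_iff, holds_untl_iff, ← not_holds_release_iff]
  simp only [not_and_or, not_or, Holds.eq_def w (neg _)]

theorem exists_ge_of_holds_untl (h : (untl ψ χ).Holds w t) : ∃ k, t ≤ k ∧ χ.Holds w k :=
  let ⟨k, hk, hχ, _⟩ := h
  ⟨k, hk, hχ⟩

theorem exists_ge_of_not_holds_release (h : ¬ (release ψ χ).Holds w t) :
    ∃ k, t ≤ k ∧ ¬ χ.Holds w k :=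
  exists_ge_of_holds_untl (not_holds_release_iff.1 h)

theorem exists_ge_of_not_holds_always (h : ¬ (always ψ).Holds w t) :
    ∃ k, t ≤ k ∧ ¬ ψ.Holds w k := by
  contrapose! h
  exact h

/-- The formula that `s` stands for in the clauses of `ψ`: `ψ` itself or one of its immediate
subformulas. As in `env`, the default for a missing subformula is `1`. -/
def operand : LTL α → Src → LTL α
  | ψ, .self => ψ
  | neg ψ, .fst | next ψ, .fst | eventually ψ, .fst | always ψ, .fst => ψ
  | or ψ _, .fst | and ψ _, .fst | untl ψ _, .fst | release ψ _, .fst => ψ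
  | or _ χ, .snd | and _ χ, .snd | untl _ χ, .snd | release _ χ, .snd => χ
  | _, _ => tru

/-- The polarity of `ψ.operand s` in an occurrence of `ψ` of polarity `b`. -/
def operandPolarity (b : Bool) : LTL α → Src → Bool
  | neg _, .fst => !b
  | _, _ => b

end LTL

/-- The position of the occurrence that `s` stands for in the clauses of the occurrence at
position `p`. -/
def Src.position (p : List Bool) : Src → List Bool
  | .self => p
  | .fst => p ++ [false]
  | .snd => p ++ [true]

/-- The truth value at time `t` of a literal of a scheme when `e s` are the truth values of the
proposition of `s`. -/
def SLit.Holds (e : Src → ℕ → Prop) : SLit → ℕ → Prop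
  | (true, s), t => e s t
  | (false, s), t => ¬ e s t

/-- The truth value at time `t` of a disjunction of literals of a scheme when `e s` are the truth
values of the proposition of `s`. -/
def SDisjHolds (e : Src → ℕ → Prop) : List SLit → ℕ → Prop
  | [], _ => False
  | l :: L, t => l.Holds e t ∨ SDisjHolds e L t

/-- What the scheme says about time `t` when `e s` are the truth values of the proposition of
`s`. -/
def Scheme.HoldsAt (e : Src → ℕ → Prop) : Scheme → ℕ → Prop
  | .step P Q, t => SDisjHolds e P t ∨ SDisjHolds e Q (t + 1)
  | .ev P l, t => SDisjHolds e P t ∨ ∃ k, t ≤ k ∧ l.Holds e k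

section Schemes

variable {e e' : Src → ℕ → Prop} {t : ℕ}

theorem SLit.holds_congr {l : SLit} (h : e l.2 = e' l.2) : l.Holds e t ↔ l.Holds e' t := by
  rcases l with ⟨_ | _, s⟩ <;> simp only [SLit.Holds, h]

theorem sDisjHolds_congr {L : List SLit} (h : ∀ l ∈ L, e l.2 = e' l.2) :
    SDisjHolds e L t ↔ SDisjHolds e' L t := by
  induction L with
  | nil => rfl
  | cons l L ih =>
    obtain ⟨hl, hL⟩ := List.forall_mem_cons.1 h
    exact or_congr (SLit.holds_congr hl) (ih hL)

theorem Scheme.holdsAt_congr {r : Scheme} (h : ∀ l ∈ r.lits, e l.2 = e' l.2) :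
    r.HoldsAt e t ↔ r.HoldsAt e' t := by
  cases r with
  | step P Q =>
    obtain ⟨hP, hQ⟩ := List.forall_mem_append.1 h
    exact or_congr (sDisjHolds_congr hP) (sDisjHolds_congr hQ)
  | ev P l =>
    obtain ⟨hP, hl⟩ := List.forall_mem_append.1 h
    refine or_congr (sDisjHolds_congr hP) (exists_congr fun k => and_congr_right fun _ => ?_)
    exact SLit.holds_congr (hl l (List.mem_singleton_self l))

theorem LTL.holdsAt_of_mem_schemes {α : Type*} {b : Bool} {ψ : LTL α} {r : Scheme}
    (hr : r ∈ schemes b ψ) (w : ℕ → Set α) (t : ℕ) :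
    r.HoldsAt (fun s => (ψ.operand s).Holds w) t := by
  cases ψ with
  | tru | fls | atom => cases b <;> cases hr
  | neg | or | and | next =>
    cases b <;> fin_cases hr <;>
      simp only [Scheme.HoldsAt, SDisjHolds, SLit.Holds, operand, Holds] <;> tauto
  | eventually ψ =>
    have hunfold := holds_eventually_iff (w := w) (ψ := ψ) (t := t)
    have hev : (eventually ψ).Holds w t ↔ ∃ k, t ≤ k ∧ ψ.Holds w k := .rfl
    cases b <;> fin_cases hr <;>
      simp only [Scheme.HoldsAt, SDisjHolds, SLit.Holds, operand] <;> tauto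
  | always ψ =>
    have hunfold := holds_always_iff (w := w) (ψ := ψ) (t := t)
    have hev := exists_ge_of_not_holds_always (w := w) (ψ := ψ) (t := t)
    cases b <;> fin_cases hr <;>
      simp only [Scheme.HoldsAt, SDisjHolds, SLit.Holds, operand] <;> tauto
  | untl ψ χ =>
    have hunfold := holds_untl_iff (w := w) (ψ := ψ) (χ := χ) (t := t)
    have hev := exists_ge_of_holds_untl (w := w) (ψ := ψ) (χ := χ) (t := t)
    cases b <;> fin_cases hr <;>
      simp only [Scheme.HoldsAt, SDisjHolds, SLit.Holds, operand] <;> tauto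
  | release ψ χ =>
    have hunfold := holds_release_iff (w := w) (ψ := ψ) (χ := χ) (t := t)
    have hev := exists_ge_of_not_holds_release (w := w) (ψ := ψ) (χ := χ) (t := t)
    cases b <;> fin_cases hr <;>
      simp only [Scheme.HoldsAt, SDisjHolds, SLit.Holds, operand] <;> tauto

end Schemes

section Instantiation

variable {α : Type*}

/-- The truth value of a reference at time `t` of the infinite word `w`. -/
def Ref.Holds (w : ℕ → Set (SAtom α)) : Ref α → ℕ → Prop
  | .const v, _ => v = true
  | .prop p, t => p ∈ w t

/-- The truth value at time `t` of the infinite word `w` of a disjunct to be simplified by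
`disj`. -/
def SignedHolds (w : ℕ → Set (SAtom α)) : Bool ⊕ Lit α → ℕ → Prop
  | .inl v, _ => v = true
  | .inr l, t => l.Holds w t

variable {w : ℕ → Set (SAtom α)} {env : Src → Ref α} {t : ℕ}

theorem signedHolds_signed {l : SLit} :
    SignedHolds w ((env l.2).signed l.1) t ↔ l.Holds (fun s => (env s).Holds w) t := by
  rcases l with ⟨_ | _, s⟩ <;> rcases h : env s with (_ | _) | p <;>
    simp [h, Ref.signed, SignedHolds, SLit.Holds, Ref.Holds, Lit.Holds]

variable [DecidableEq α]

theorem disjHolds_disj_iff {L : List SLit} {P : Finset (Lit α)}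
    (h : disj (L.map fun l => (env l.2).signed l.1) = some P) :
    DisjHolds w P t ↔ SDisjHolds (fun s => (env s).Holds w) L t := by
  induction L generalizing P with
  | nil =>
    obtain rfl := Option.some.inj h
    exact iff_of_false not_disjHolds_empty id
  | cons l L ih =>
    rw [SDisjHolds, ← signedHolds_signed]
    rw [List.map_cons] at h
    generalize (env l.2).signed l.1 = x at h ⊢
    rcases x with (_ | _) | l'
    · exact (ih h).trans (or_iff_right Bool.false_ne_true).symm
    · cases h
    · obtain ⟨Q, hQ, rfl⟩ := Option.map_eq_some_iff.1 h
      exact disjHolds_insert.trans (or_congr_right (ih hQ))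

theorem Scheme.holdsAt_inst_iff {r : Scheme} {c : Clause α} (h : r.inst env = some c) :
    c.HoldsAt w t ↔ r.HoldsAt (fun s => (env s).Holds w) t := by
  cases r with
  | step P Q =>
    simp only [Scheme.inst] at h
    split at h
    next P' Q' hP hQ =>
      obtain rfl := Option.some.inj h
      exact or_congr (disjHolds_disj_iff hP) (disjHolds_disj_iff hQ)
    next => cases h
  | ev P l =>
    simp only [Scheme.HoldsAt, ← signedHolds_signed]
    simp only [Scheme.inst] at h
    split at h
    next => cases h
    next => cases h
    next P' hP hl =>
      obtain rfl := Option.some.inj h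
      rw [hl, Clause.holdsAt_global_empty_right, disjHolds_disj_iff hP]
      exact (or_iff_left fun ⟨_, _, hfalse⟩ => Bool.false_ne_true hfalse).symm
    next P' l' hP hl =>
      obtain rfl := Option.some.inj h
      rw [hl]
      exact or_congr_left (disjHolds_disj_iff hP)

end Instantiation

namespace LTL

variable {α : Type*}

/-- Polarity and formula of the occurrence of a subformula of `φ` at position `p`. The default
for a missing subformula is `1`. -/
def occurrence (φ : LTL α) (p : List Bool) : Bool × LTL α :=
  p.foldl (init := (true, φ)) fun o d =>
    let s := if d then Src.snd else Src.fst
    (o.2.operandPolarity o.1 s, o.2.operand s)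

variable {φ ψ : LTL α} {p : List Bool} {b : Bool} {s : Src}

theorem occurrence_position (h : φ.occurrence p = (b, ψ)) (s : Src) :
    φ.occurrence (s.position p) = (ψ.operandPolarity b s, ψ.operand s) := by
  cases s with
  | self => cases ψ <;> exact h
  | fst | snd =>
    unfold occurrence at h
    simp [occurrence, Src.position, List.foldl_append, h]

theorem env_eq_ref_operand (p : List Bool) (ψ : LTL α) (s : Src) :
    ψ.env p s = (ψ.operand s).ref (s.position p) := by
  cases ψ <;> cases s <;> rfl

variable [DecidableEq α] {C : Set (Clause α)} {c : Clause α}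

theorem exists_mem_nodeClauses_of_mem_snfAux (hψ : φ.occurrence p = (b, ψ))
    (hc : c ∈ snfAux p b ψ) :
    ∃ q b' χ, φ.occurrence q = (b', χ) ∧ c ∈ nodeClauses q b' χ := by
  induction ψ generalizing p b with
  | tru | fls | atom => cases hc
  | neg ψ ih | next ψ ih | eventually ψ ih | always ψ ih =>
    rcases List.mem_append.1 hc with hc | hc
    · exact ⟨p, b, _, hψ, hc⟩
    · exact ih (occurrence_position hψ .fst) hc
  | or ψ χ ihψ ihχ | and ψ χ ihψ ihχ | untl ψ χ ihψ ihχ | release ψ χ ihψ ihχ =>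
    rcases List.mem_append.1 hc with hc | hc
    · rcases List.mem_append.1 hc with hc | hc
      · exact ⟨p, b, _, hψ, hc⟩
      · exact ihψ (occurrence_position hψ .fst) hc
    · exact ihχ (occurrence_position hψ .snd) hc

theorem schemes_liftAux (b b' : Bool) (C : Set (Clause α)) (p : List Bool) (ψ : LTL α) :
    schemes b (liftAux C p b' ψ) = schemes b ψ := by
  cases ψ <;> cases b <;> rfl

theorem operand_liftAux (hs : s = .self ∨ Uses C p b ψ s) :
    (liftAux C p b ψ).operand s =
      liftAux C (s.position p) (ψ.operandPolarity b s) (ψ.operand s) := by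
  rcases hs with rfl | hs
  · cases ψ <;> rfl
  · cases ψ <;> cases s <;> first | rfl | exact if_pos hs

/-- The interpretation of the propositions of the SNF of `φ` over the infinite word `w` in which
the proposition of each occurrence of a subformula has the truth value of the lifted occurrence,
and each "wait for" proposition its intended one. -/
def coreWord (w : ℕ → Set α) (C : Set (Clause α)) (φ : LTL α) (t : ℕ) : Set (SAtom α) :=
  {q | holds q t}
where
  /-- The truth value of a proposition at time `t`. -/
  holds : SAtom α → ℕ → Prop
  | .ap a, t => a ∈ w t
  | .x p, t => (liftAux C p (φ.occurrence p).1 (φ.occurrence p).2).Holds w t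
  | .wait s q, t => ∃ k, t < k ∧ (holds q k ↔ s = true)

variable {w : ℕ → Set α} {t : ℕ}

theorem interpretsWaitFor_coreWord : InterpretsWaitFor (coreWord w C φ) := fun _ _ =>
  iff_true_right rfl

theorem holds_ref_coreWord_iff (hψ : φ.occurrence p = (b, ψ)) :
    (ψ.ref p).Holds (coreWord w C φ) t ↔ (liftAux C p b ψ).Holds w t := by
  have hx : .x p ∈ coreWord w C φ t ↔ (liftAux C p b ψ).Holds w t := by
    change (liftAux C p (φ.occurrence p).1 (φ.occurrence p).2).Holds w t ↔ _
    rw [hψ]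
  cases ψ with
  | tru => exact iff_of_true rfl trivial
  | fls => exact iff_of_false Bool.false_ne_true id
  | atom => rfl
  | _ => exact hx

theorem holds_env_coreWord_iff (hψ : φ.occurrence p = (b, ψ)) (hs : s = .self ∨ Uses C p b ψ s) :
    (ψ.env p s).Holds (coreWord w C φ) t ↔ ((liftAux C p b ψ).operand s).Holds w t := by
  rw [env_eq_ref_operand, operand_liftAux hs, holds_ref_coreWord_iff (occurrence_position hψ s)]

theorem valid_of_mem_nodeClauses (hψ : φ.occurrence p = (b, ψ)) (hcC : c ∈ C)
    (hc : c ∈ nodeClauses p b ψ) : c.Valid (coreWord w C φ) := by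
  obtain ⟨r, hr, hrc⟩ := List.mem_filterMap.1 hc
  intro t
  have hlift : r.HoldsAt (fun s => ((liftAux C p b ψ).operand s).Holds w) t :=
    holdsAt_of_mem_schemes (by rwa [schemes_liftAux]) w t
  rw [Scheme.holdsAt_inst_iff hrc]
  refine (Scheme.holdsAt_congr fun l hl => funext fun t => propext ?_).2 hlift
  exact holds_env_coreWord_iff hψ (.inr ⟨r, hr, ⟨l.1, hl⟩, c, hcC, hrc⟩)

theorem valid_of_mem_snf (hw : (φ.lift C).Holds w 0) (hcC : c ∈ C) (hc : c ∈ φ.snf) :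
    c.Valid (coreWord w C φ) := by
  have hφ : φ.occurrence [] = (true, φ) := rfl
  rcases Finset.mem_union.1 hc with hc | hc
  · obtain ⟨P, hP, rfl⟩ := Option.map_eq_some_iff.1 (Option.mem_toFinset.1 hc)
    intro _
    exact (disjHolds_disj_iff (L := [(true, .self)]) (env := φ.env []) hP).2
      (.inl ((holds_ref_coreWord_iff hφ).2 hw))
  · obtain ⟨p, b, ψ, hψ, hc⟩ := exists_mem_nodeClauses_of_mem_snfAux hφ (List.mem_toFinset.1 hc)
    exact valid_of_mem_nodeClauses hψ hcC hc

theorem snfSatisfiable_of_lift (hC : C ⊆ φ.snf) (h : (φ.lift C).Satisfiable) :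
    SNFSatisfiable C :=
  let ⟨w, hw⟩ := h
  ⟨coreWord w C φ, interpretsWaitFor_coreWord, fun _ hc => valid_of_mem_snf hw hc (hC hc)⟩

end LTL

theorem mainTheorem2 {α : Type*} [DecidableEq α] (φ φuc : LTL α) (hφ : ¬ φ.Satisfiable)
    (huc : IsCoreInLTL φ φuc) : ¬ φuc.Satisfiable := by
  obtain ⟨C, hC, rfl⟩ := huc
  exact fun h => hC.not_snfSatisfiable (LTL.snfSatisfiable_of_lift hC.subset h)
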